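/- Let $\lambda = 25 - 11\left(\tfrac{48332}{114345}+\tfrac{16}{33}\log 2\right)$ ($\log$ is the natural logarithm), so that $\lambda \approx 16.6537$ to four decimal places. All graphs are finite and simple. The Euler genus of the sphere with $h$ handles is $2h$, that of the sphere with $c$ cross-caps is $c$, and the Euler genus of a graph is the minimum Euler genus of a surface in which it embeds. A sequence $v_1,\dots,v_s$ of vertices of a graph is ordered if $\left|N[v_i]\cap\bigcup_{j<i}N[v_j]\right|\le 2$ for every $i\in\{1,\dots,s\}$, where $N[v]=N(v)\cup\{v\}$ is the closed neighbourhood of $v$. For integers $g\ge 0$ and $s\ge 1$, let $f_g(s)$ be the least integer $b$ such that for every bipartite graph $G$ with Euler genus at most $g$ and every bipartition $(A,B)$ of $G$ with $|B|>b$ in which every vertex in $B$ has degree at most $4$, the set $B$ contains an ordered sequence of $s$ distinct vertices. Then for every integer $g\ge 2$ the number $f_g(g+1)$ exists (that is, there is such an integer $b$ for $s=g+1$), and $$f_g(g+1)\le \lambda(g-2)+2\left\lceil\sqrt{\tfrac32(g-2)}\right\rceil+33 .$$ -/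

import Mathlib

/-- A combinatorial embedding of a simple graph in surfaces, given by a rotation at every vertex
(a cyclic ordering of the darts leaving it) and a signature on the edges.  Only the values of
`sign` on edges of `G` matter.  Each connected component is thereby embedded with all faces
open discs in some closed surface, orientable or not. -/
structure EmbeddingScheme {V : Type*} (G : SimpleGraph V) where
  /-- the successor of a dart in the rotation at its initial vertex -/
  rot : Equiv.Perm G.Dart
  /-- the signature of an edge -/
  sign : Sym2 V → ℤˣ
  rot_fst : ∀ d : G.Dart, (rot d).fst = d.fst
  rot_cyclic : ∀ d d' : G.Dart, d.fst = d'.fst → rot.SameCycle d d'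

namespace EmbeddingScheme

variable {V : Type*} {G : SimpleGraph V}

/-- Face tracing.  A flag `(d, ε)` is a dart `d` about to be traversed with current local
orientation `ε`.  Traverse `d`, multiply the orientation by the signature of the edge, and leave
the end of `d` along the successor (for orientation `1`) or the predecessor (for `-1`) of the
reversed dart. -/
def faceStep (S : EmbeddingScheme G) (x : G.Dart × ℤˣ) : G.Dart × ℤˣ :=
  ((S.rot ^ ((x.2 * S.sign x.1.edge : ℤˣ) : ℤ)) x.1.symm, x.2 * S.sign x.1.edge)

/-- The flag at which the same side of the same edge is traversed in the opposite direction. -/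
def reverse (S : EmbeddingScheme G) (x : G.Dart × ℤˣ) : G.Dart × ℤˣ :=
  (x.1.symm, -(x.2 * S.sign x.1.edge))

/-- The faces with at least one edge on the boundary: facial walks up to reversal. -/
def Face (S : EmbeddingScheme G) : Type _ :=
  Quot fun x y : G.Dart × ℤˣ => y = S.faceStep x ∨ y = S.reverse x

/-- The number of faces, summed over the embeddings of the connected components.  An isolated
vertex is embedded in the sphere with one face. -/
noncomputable def numFaces (S : EmbeddingScheme G) : ℕ :=
  Nat.card S.Face + {v : V | G.neighborSet v = ∅}.ncard

/-- The Euler genus of the embedding of a finite graph: the sum of `2 - (|V| - |E| + |F|)` over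
the components.  It is the Euler genus of the connected sum of the surfaces that carry the
components, hence of a connected surface in which the whole graph embeds. -/
noncomputable def eulerGenus (S : EmbeddingScheme G) : ℤ :=
  2 * (Nat.card G.ConnectedComponent : ℤ) - (Nat.card V : ℤ) + (G.edgeSet.ncard : ℤ)
    - (S.numFaces : ℤ)

end EmbeddingScheme

/-- The finite graph `G` has Euler genus at most `g`. -/
def EulerGenusLE {V : Type*} (G : SimpleGraph V) (g : ℕ) : Prop :=
  ∃ S : EmbeddingScheme G, S.eulerGenus ≤ (g : ℤ)

/-- The closed neighbourhood `N[v]`. -/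
def closedNbhd {V : Type*} (G : SimpleGraph V) (v : V) : Set V :=
  insert v (G.neighborSet v)

/-- The sequence `v` of vertices of a finite graph is ordered: each `N[vᵢ]` has at most two
elements in common with the union of the `N[vⱼ]`, `j < i`. -/
def IsOrderedSeq {V : Type*} (G : SimpleGraph V) {s : ℕ} (v : Fin s → V) : Prop :=
  ∀ i : Fin s, (closedNbhd G (v i) ∩ ⋃ j : Fin s, ⋃ _ : j < i, closedNbhd G (v j)).ncard ≤ 2

/-- For every finite bipartite graph `G` of Euler genus at most `g` and every bipartition `(A, B)`
of `G` with `|B| > b` in which all vertices of `B` have degree at most 4, the class `B` contains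
an ordered sequence of `s` vertices. -/
def ForcesOrderedSeq (g s b : ℕ) : Prop :=
  ∀ (V : Type) [Fintype V] [DecidableEq V] (G : SimpleGraph V) (A B : Finset V),
    EulerGenusLE G g →
    A ∪ B = Finset.univ → G.IsBipartiteWith (A : Set V) (B : Set V) →
    b < B.card → (∀ v ∈ B, (G.neighborSet v).ncard ≤ 4) →
    ∃ v : Fin s → V, Function.Injective v ∧ (∀ i, v i ∈ B) ∧ IsOrderedSeq G v

/-- `orderedBound g s` is `f_g(s)`, the least `b` such that `ForcesOrderedSeq g s b`. -/
noncomputable def orderedBound (g s : ℕ) : ℕ :=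
  sInf {b : ℕ | ForcesOrderedSeq g s b}

/-- The constant `λ`. -/
noncomputable def lambdaConst : ℝ :=
  25 - 11 * (48332 / 114345 + 16 / 33 * Real.log 2)

/-! The stronger linear bound `10 * g` holds, by greedy extension. Let T ⊆ B be the set of terms of
an ordered sequence and U = N(T). Two vertices of B share only neighbours in A, so b ∈ B \ T can be
appended as soon as it has at most two neighbours in U. If no b can be appended, every vertex of B \
T sends at least three edges to U, while |U| ≤ 4|T|; Euler's formula then gives |B| ≤ 2g + 8|T|
(`card_le_of_three_neighbors`), which is at most 10g while |T| ≤ g. In Euler's formula, a bipartite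
graph without leaves has faces of length at least 4, so 2F ≤ E. Leaves in A \ U would spoil the
count, since there each vertex should bring two edges. They are disregarded when face lengths are
measured, which improves the face bound by one per leaf; leaves in B cost one each, and all of them
lie in T (`two_mul_card_face_add_le`). -/

/-! ### Facial walks and passing leaves -/

namespace EmbeddingScheme

variable {V : Type*} {G : SimpleGraph V}

/-- The face through a flag. -/
def faceOf (S : EmbeddingScheme G) (x : G.Dart × ℤˣ) : S.Face := Quot.mk _ x

lemma faceOf_faceStep (S : EmbeddingScheme G) (x : G.Dart × ℤˣ) :
    S.faceOf (S.faceStep x) = S.faceOf x :=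
  (Quot.sound (r := fun x y => y = S.faceStep x ∨ y = S.reverse x) (Or.inl rfl)).symm

lemma faceOf_reverse (S : EmbeddingScheme G) (x : G.Dart × ℤˣ) :
    S.faceOf (S.reverse x) = S.faceOf x :=
  (Quot.sound (r := fun x y => y = S.faceStep x ∨ y = S.reverse x) (Or.inr rfl)).symm

lemma rot_unit_fst (S : EmbeddingScheme G) (u : ℤˣ) (d : G.Dart) :
    ((S.rot ^ (u : ℤ)) d).fst = d.fst := by
  rcases Int.units_eq_one_or u with rfl | rfl
  · simpa using S.rot_fst d
  · have := S.rot_fst (S.rot⁻¹ d)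
    simpa using this.symm

lemma rot_unit_pow_fst (S : EmbeddingScheme G) (u : ℤˣ) (n : ℕ) (d : G.Dart) :
    (((S.rot ^ (u : ℤ)) ^ n) d).fst = d.fst := by
  induction n with
  | zero => simp
  | succ n ih => rw [pow_succ', Equiv.Perm.mul_apply, rot_unit_fst, ih]

lemma faceStep_fst (S : EmbeddingScheme G) (x : G.Dart × ℤˣ) :
    (S.faceStep x).1.fst = x.1.snd :=
  S.rot_unit_fst _ _

lemma reverse_reverse (S : EmbeddingScheme G) (x : G.Dart × ℤˣ) :
    S.reverse (S.reverse x) = x := by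
  obtain ⟨d, u⟩ := x
  simp [reverse, mul_assoc, Int.units_mul_self]

lemma faceStep_ne_reverse (S : EmbeddingScheme G) (x : G.Dart × ℤˣ) :
    S.faceStep x ≠ S.reverse x := by
  intro h
  have h2 := congrArg Prod.snd h
  exact units_ne_neg_self _ h2

/-- Passing through a vertex of degree one, a facial walk returns along the same edge and goes on
along the next dart of the rotation in the same direction. -/
lemma faceOf_skip_leaf (S : EmbeddingScheme G) (c : G.Dart) (u : ℤˣ)
    (h : ∀ e : G.Dart, e.fst = c.snd → e = c.symm) :
    S.faceOf ((S.rot ^ (u : ℤ)) c, u) = S.faceOf (c, u) := by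
  have h1 : S.faceStep (c, u) = (c.symm, u * S.sign c.edge) := by
    refine Prod.ext ?_ rfl
    exact h _ (S.rot_unit_fst _ _)
  have h2 : S.faceStep (c.symm, u * S.sign c.edge) = ((S.rot ^ (u : ℤ)) c, u) := by
    have : u * S.sign c.edge * S.sign c.symm.edge = u := by
      rw [SimpleGraph.Dart.edge_symm, mul_assoc, Int.units_mul_self, mul_one]
    simp only [faceStep, this, SimpleGraph.Dart.symm_symm]
  rw [← h2, faceOf_faceStep, ← h1, faceOf_faceStep]

/-- A facial walk arriving at a vertex goes on, after visits to leaves from `P` only, along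
another dart that does not lead to `P`. -/
lemma exists_next_of_leaves [Finite V] (S : EmbeddingScheme G) (P : V → Prop)
    (hP : ∀ v, P v → ∀ e e' : G.Dart, e.fst = v → e'.fst = v → e = e')
    (x : G.Dart × ℤˣ) (hx : ∃ e : G.Dart, e.fst = x.1.snd ∧ e ≠ x.1.symm ∧ ¬ P e.snd) :
    ∃ e : G.Dart, e.fst = x.1.snd ∧ e ≠ x.1.symm ∧ ¬ P e.snd ∧
      S.faceOf (e, x.2 * S.sign x.1.edge) = S.faceOf x := by
  classical
  obtain ⟨d, ε⟩ := x
  set u : ℤˣ := ε * S.sign d.edge with hu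
  set ρ : Equiv.Perm G.Dart := S.rot ^ (u : ℤ) with hρ
  have hfin : Finite G.Dart := Finite.of_injective _ SimpleGraph.Dart.toProd_injective
  obtain ⟨e₀, he₀, hne₀, hP₀⟩ := hx
  have hcyc : ρ.SameCycle d.symm e₀ := by
    have h := S.rot_cyclic d.symm e₀ he₀.symm
    rcases Int.units_eq_one_or u with h1 | h1
    · simpa [hρ, h1] using h
    · simpa [hρ, h1] using h
  have hex : ∃ n : ℕ, (ρ ^ n) d.symm ≠ d.symm ∧ ¬ P ((ρ ^ n) d.symm).snd := by
    obtain ⟨n, -, hn⟩ := hcyc.exists_pow_eq'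
    exact ⟨n, by rw [hn]; exact ⟨hne₀, hP₀⟩⟩
  have hmin := fun m => Nat.find_min (m := m) hex
  obtain ⟨hn1, hn2⟩ := Nat.find_spec hex
  set n := Nat.find hex with hn
  have hfst : ∀ m : ℕ, ((ρ ^ m) d.symm).fst = d.snd := fun m => S.rot_unit_pow_fst u m _
  have key : ∀ m : ℕ, m + 1 ≤ n → S.faceOf ((ρ ^ (m + 1)) d.symm, u) = S.faceOf (d, ε) := by
    intro m
    induction m with
    | zero =>
      intro _
      rw [zero_add, pow_one]
      exact S.faceOf_faceStep (d, ε)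
    | succ m ih =>
      intro hm
      -- If the rotation came back to `d.symm` before step `n`, the dart found at step `n` would
      -- already have appeared at step `n - (m + 1)`.
      have hne : (ρ ^ (m + 1)) d.symm ≠ d.symm := by
        intro heq
        have h2 : (ρ ^ (n - (m + 1))) d.symm = (ρ ^ n) d.symm := by
          conv_lhs => rw [← heq]
          rw [← Equiv.Perm.mul_apply, ← pow_add]
          congr 2
          omega
        exact hmin (n - (m + 1)) (by omega) (by rw [h2]; exact ⟨hn1, hn2⟩)
      have hPm : P ((ρ ^ (m + 1)) d.symm).snd := by
        by_contra h
        exact hmin (m + 1) (by omega) ⟨hne, h⟩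
      rw [← ih (by omega), pow_succ' ρ (m + 1), Equiv.Perm.mul_apply]
      exact S.faceOf_skip_leaf _ _ fun e he => hP _ hPm e _ he rfl
  have hn0 : n ≠ 0 := by
    intro h
    rw [h] at hn1
    simp at hn1
  obtain ⟨m, hm⟩ := Nat.exists_eq_succ_of_ne_zero hn0
  exact ⟨(ρ ^ n) d.symm, hfst n, hn1, hn2, by rw [hm]; exact key m (by omega)⟩

end EmbeddingScheme

namespace SimpleGraph

variable {V : Type*} {G : SimpleGraph V}

lemma Dart.eq_of_fst_of_degree_eq_one [Fintype V] [DecidableRel G.Adj] {v : V}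
    (hv : G.degree v = 1) (e e' : G.Dart) (he : e.fst = v) (he' : e'.fst = v) : e = e' := by
  obtain ⟨w, -, hw⟩ := (G.degree_eq_one_iff_existsUnique_adj).1 hv
  have h1 := hw e.snd (he ▸ e.adj)
  have h2 := hw e'.snd (he' ▸ e'.adj)
  exact SimpleGraph.Dart.ext _ _ (Prod.ext (he.trans he'.symm) (h1.trans h2.symm))

lemma Dart.symm_ne_of_snd_ne {d e : G.Dart} (h : e.snd ≠ d.fst) : e ≠ d.symm := by
  rintro rfl
  exact h rfl

end SimpleGraph

/-! ### Counting faces by weighted flags -/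

namespace EmbeddingScheme

variable {V : Type*} {G : SimpleGraph V}

open Finset SimpleGraph

/-- The flags traversed from `A` get weight `0` when they start at a leaf from `L`, weight `2` when
they end at a leaf, and weight `1` otherwise. -/
def flagWeight [Fintype V] [DecidableEq V] [DecidableRel G.Adj] (A L : Finset V)
    (x : G.Dart × ℤˣ) : ℕ :=
  if x.1.fst ∈ A \ L then (if G.degree x.1.snd = 1 then 2 else 1) else 0

section Bipartite

variable [Fintype V] [DecidableEq V] [DecidableRel G.Adj] {A B L : Finset V}

/-- A face contains its facial walk in both directions. With visits to `L` skipped, the walk has two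
different edges at each visit to a vertex of B that is not a leaf, so two successive visits supply
four flags starting in A \ L. A visit to a leaf of B supplies only the two sides of the pendant
edge, hence the weight 2. The hypothesis `hB` provides the second edge after the leaves in `L` are
skipped. -/
lemma four_le_sum_flagWeight (S : EmbeddingScheme G) (hAB : G.IsBipartiteWith (A : Set V) B)
    (hL : ∀ a ∈ L, G.degree a = 1)
    (hB : ∀ b ∈ B, ∀ a, G.Adj b a →
      (G.degree b = 1 ∧ a ∉ L) ∨ ∃ a', a' ≠ a ∧ G.Adj b a' ∧ a' ∉ L)
    [DecidableEq S.Face] (f : S.Face) :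
    4 ≤ ∑ x with S.faceOf x = f, flagWeight A L x := by
  have hdisj : ∀ v, v ∈ A → v ∈ B → False := fun v h1 h2 =>
    Set.disjoint_left.1 hAB.disjoint (mem_coe.2 h1) (mem_coe.2 h2)
  have hAdj : ∀ {v w}, G.Adj v w → (v ∈ A ∧ w ∈ B) ∨ (v ∈ B ∧ w ∈ A) := fun h => by
    simpa using hAB.mem_of_adj h
  have toB : ∀ d : G.Dart, d.fst ∈ A → d.snd ∈ B := fun d hd =>
    (hAdj d.adj).elim (fun h => h.2) fun h => (hdisj _ hd h.1).elim
  have toA : ∀ d : G.Dart, d.fst ∈ B → d.snd ∈ A := fun d hd =>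
    (hAdj d.adj).elim (fun h => (hdisj _ h.1 hd).elim) fun h => h.2
  have wpos : ∀ x : G.Dart × ℤˣ, x.1.fst ∈ A → x.1.fst ∉ L → 1 ≤ flagWeight A L x := by
    intro x h1 h2
    rw [flagWeight, if_pos (mem_sdiff.2 ⟨h1, h2⟩)]
    split_ifs <;> omega
  have wtwo : ∀ x : G.Dart × ℤˣ, x.1.fst ∈ A → x.1.fst ∉ L → G.degree x.1.snd = 1 →
      2 ≤ flagWeight A L x := by
    intro x h1 h2 h3
    rw [flagWeight, if_pos (mem_sdiff.2 ⟨h1, h2⟩), if_pos h3]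
  have leaf : ∀ v, v ∈ L → ∀ e e' : G.Dart, e.fst = v → e'.fst = v → e = e' := fun v hv =>
    SimpleGraph.Dart.eq_of_fst_of_degree_eq_one (hL v hv)
  have corner : ∀ x : G.Dart × ℤˣ, x.1.fst ∈ A → G.degree x.1.snd ≠ 1 →
      ∃ e : G.Dart, e.fst = x.1.snd ∧ e.snd ≠ x.1.fst ∧ e.snd ∉ L ∧
      S.faceOf (e, x.2 * S.sign x.1.edge) = S.faceOf x := by
    intro x hxA hx
    obtain ⟨a', h1, h2, h3⟩ := (hB _ (toB _ hxA) x.1.fst x.1.adj.symm).resolve_left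
      fun h => hx h.1
    obtain ⟨e, he1, he2, he3, he4⟩ := S.exists_next_of_leaves (· ∈ L) leaf x
      ⟨⟨(x.1.snd, a'), h2⟩, rfl, SimpleGraph.Dart.symm_ne_of_snd_ne h1, h3⟩
    refine ⟨e, he1, fun h => he2 ?_, he3, he4⟩
    exact SimpleGraph.Dart.ext _ _ (Prod.ext he1 h)
  have pendant : ∀ x : G.Dart × ℤˣ, S.faceOf x = f → x.1.fst ∈ A → x.1.fst ∉ L →
      G.degree x.1.snd = 1 → 4 ≤ ∑ x with S.faceOf x = f, flagWeight A L x := by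
    intro x hx hxA hxL hdeg
    -- The walk turns back at the leaf, so both sides of the pendant edge lie on this face: `x` and
    -- `y` are the two flags on the same dart.
    set y := S.reverse (S.faceStep x) with hy
    have hyd : y.1 = x.1 := by
      have : (S.faceStep x).1 = x.1.symm :=
        SimpleGraph.Dart.eq_of_fst_of_degree_eq_one hdeg _ _ (S.faceStep_fst x) rfl
      simp [hy, reverse, this]
    have hyx : x ≠ y := by
      intro h
      apply S.faceStep_ne_reverse x
      rw [← S.reverse_reverse (S.faceStep x), ← hy, ← h]
    have hyf : S.faceOf y = f := by rw [hy, faceOf_reverse, faceOf_faceStep, hx]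
    have hsub : ({x, y} : Finset (G.Dart × ℤˣ)) ⊆ univ.filter fun x => S.faceOf x = f := by
      intro v hv
      simp only [mem_insert, mem_singleton] at hv
      rcases hv with rfl | rfl <;> simpa
    have h1 := sum_le_sum_of_subset (f := flagWeight A L) hsub
    rw [sum_pair hyx] at h1
    have h2 := wtwo x hxA hxL hdeg
    have h3 := wtwo y (hyd ▸ hxA) (hyd ▸ hxL) (hyd ▸ hdeg)
    omega
  have start : ∃ x, S.faceOf x = f ∧ x.1.fst ∈ A ∧ x.1.fst ∉ L := by
    have h1 : ∃ x, S.faceOf x = f ∧ x.1.fst ∈ A := by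
      obtain ⟨x, rfl⟩ : ∃ x, S.faceOf x = f := Quot.exists_rep f
      rcases hAdj x.1.adj with h | h
      · exact ⟨x, rfl, h.1⟩
      · exact ⟨S.reverse x, S.faceOf_reverse x, h.2⟩
    obtain ⟨x, hx, hxA⟩ := h1
    -- A walk that starts at a disregarded leaf next leaves for a vertex outside `L`; reversing that
    -- edge gives a suitable flag.
    by_cases hxL : x.1.fst ∈ L
    · have hdeg : G.degree x.1.snd ≠ 1 := by
        intro h
        rcases hB _ (toB _ hxA) x.1.fst x.1.adj.symm with h' | ⟨a', h1, h2, -⟩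
        · exact h'.2 hxL
        · obtain ⟨w, -, hw⟩ := (G.degree_eq_one_iff_existsUnique_adj).1 h
          exact h1 ((hw _ h2).trans (hw _ x.1.adj.symm).symm)
      obtain ⟨e, he1, -, he3, he4⟩ := corner x hxA hdeg
      exact ⟨S.reverse (e, x.2 * S.sign x.1.edge), by rw [faceOf_reverse, he4, hx],
        toA e (he1 ▸ toB _ hxA), he3⟩
    · exact ⟨x, hx, hxA, hxL⟩
  obtain ⟨x, hx, hxA, hxL⟩ := start
  by_cases hxd : G.degree x.1.snd = 1
  · exact pendant x hx hxA hxL hxd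
  obtain ⟨e, he1, he2, he3, he4⟩ := corner x hxA hxd
  have heA : e.snd ∈ A := toA e (he1 ▸ toB _ hxA)
  set u := x.2 * S.sign x.1.edge with hu
  set z := S.faceStep (e, u) with hz
  have hz1 : z.1.fst = e.snd := S.faceStep_fst _
  have hzf : S.faceOf z = f := by rw [hz, faceOf_faceStep, he4, hx]
  by_cases hzd : G.degree z.1.snd = 1
  · exact pendant z hzf (hz1 ▸ heA) (hz1 ▸ he3) hzd
  obtain ⟨e', he1', he2', he3', he4'⟩ := corner z (hz1 ▸ heA) hzd
  have heA' : e'.snd ∈ A := toA e' (he1' ▸ toB _ (hz1 ▸ heA))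
  set y := S.reverse (e, u) with hy
  set w := S.reverse (e', z.2 * S.sign z.1.edge) with hw
  have hy1 : y.1.fst = e.snd := rfl
  have hw1 : w.1.fst = e'.snd := rfl
  rw [hz1] at he2'
  have hyf : S.faceOf y = f := by rw [hy, faceOf_reverse, he4, hx]
  have hwf : S.faceOf w = f := by rw [hw, faceOf_reverse, he4', hzf]
  have hxz : x ≠ z := by rintro h; rw [← hz1, ← h] at he2; exact he2 rfl
  have hxy : x ≠ y := by rintro h; rw [← hy1, ← h] at he2; exact he2 rfl
  have hzy : z ≠ y := S.faceStep_ne_reverse _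
  have hzw : z ≠ w := by rintro h; rw [← hw1, ← h] at he2'; exact he2' hz1
  have hyw : y ≠ w := by rintro h; rw [← hw1, ← h] at he2'; exact he2' hy1
  -- The only coincidence not excluded by initial vertices: `z` would run back along `e`, and the
  -- local orientation would have to equal its own negative.
  have hxw : x ≠ w := by
    intro h
    have hr : S.reverse x = (e', z.2 * S.sign z.1.edge) := by rw [h, hw, reverse_reverse]
    have h1 : e'.fst = x.1.snd := by rw [← congrArg (fun t => t.1.fst) hr]; rfl
    have h2 : -u = z.2 * S.sign z.1.edge := congrArg Prod.snd hr
    have hzd : z.1 = e.symm :=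
      SimpleGraph.Dart.ext _ _ (Prod.ext hz1 (he1'.symm.trans (h1.trans he1.symm)))
    have hz2 : z.2 = u * S.sign e.edge := rfl
    rw [hzd, hz2, SimpleGraph.Dart.edge_symm, mul_assoc, Int.units_mul_self, mul_one] at h2
    exact units_ne_neg_self _ h2.symm
  have hsub : ({x, z, y, w} : Finset (G.Dart × ℤˣ)) ⊆ univ.filter fun x => S.faceOf x = f := by
    intro v hv
    simp only [mem_insert, mem_singleton] at hv
    rcases hv with rfl | rfl | rfl | rfl <;> simpa
  have h1 := sum_le_sum_of_subset (f := flagWeight A L) hsub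
  rw [sum_insert (by simp [hxz, hxy, hxw]), sum_insert (by simp [hzy, hzw]), sum_pair hyw] at h1
  have h2 := wpos x hxA hxL
  have h3 := wpos z (hz1 ▸ heA) (hz1 ▸ he3)
  have h4 := wpos y heA he3
  have h5 := wpos w heA' he3'
  omega

lemma sum_dart_fst (g : V → ℕ) : ∑ d : G.Dart, g d.fst = ∑ v, G.degree v * g v := by
  rw [← sum_fiberwise (univ : Finset G.Dart) (fun d => d.fst)]
  refine sum_congr rfl fun v _ => ?_
  rw [sum_congr rfl (g := fun _ => g v) fun d hd => by rw [(mem_filter.1 hd).2],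
    sum_const, smul_eq_mul, G.dart_fst_fiber_card_eq_degree]

lemma sum_dart_snd (g : V → ℕ) : ∑ d : G.Dart, g d.snd = ∑ v, G.degree v * g v := by
  rw [← sum_dart_fst]
  exact Fintype.sum_equiv (Equiv.ofBijective _ (SimpleGraph.Dart.symm_involutive (G := G)).bijective)
    _ _ fun d => rfl

/-- Each edge has two flags directed from A to B, one for each orientation. Edges at `L` lose both,
and edges at leaves of B count twice. -/
lemma sum_flagWeight_add_le (hAB : G.IsBipartiteWith (A : Set V) B)
    (hLA : L ⊆ A) (hL : ∀ a ∈ L, G.degree a = 1) :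
    ∑ x, flagWeight (G := G) A L x + 2 * #L ≤ 2 * (#G.edgeFinset + #{b ∈ B | G.degree b = 1}) := by
  have hpt : ∀ d : G.Dart, (flagWeight A L (d, 1) + if d.fst ∈ L then 1 else 0) ≤
      (if d.fst ∈ A then 1 else 0) + (if d.snd ∈ ({b ∈ B | G.degree b = 1} : Finset V) then 1
        else 0) := by
    intro d
    by_cases h : d.fst ∈ A
    · have hb : d.snd ∈ B := by
        have := hAB.mem_of_mem_adj (mem_coe.2 h) d.adj
        simpa using this
      by_cases hl : d.fst ∈ L <;> by_cases hd : G.degree d.snd = 1 <;>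
        simp [flagWeight, h, hl, hb, hd]
    · have hl : d.fst ∉ L := fun h' => h (hLA h')
      simp [flagWeight, h, hl]
  have h1 : ∑ x, flagWeight (G := G) A L x = 2 * ∑ d : G.Dart, flagWeight A L (d, 1) := by
    rw [Fintype.sum_prod_type, mul_sum]
    refine sum_congr rfl fun d _ => ?_
    have h : ∀ u : ℤˣ, flagWeight A L (d, u) = flagWeight A L (d, 1) := fun _ => rfl
    simp only [h, sum_const, card_univ, Fintype.card_units_int, smul_eq_mul]
  have h2 := sum_le_sum fun d (_ : d ∈ (univ : Finset G.Dart)) => hpt d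
  rw [sum_add_distrib, sum_add_distrib, sum_dart_fst (fun v => if v ∈ L then 1 else 0),
    sum_dart_fst (fun v => if v ∈ A then 1 else 0),
    sum_dart_snd (fun v => if v ∈ ({b ∈ B | G.degree b = 1} : Finset V) then 1 else 0)] at h2
  simp only [mul_ite, mul_one, mul_zero, sum_ite_mem, univ_inter] at h2
  rw [isBipartiteWith_sum_degrees_eq_card_edges hAB, sum_congr rfl hL,
    sum_congr rfl (g := fun _ => 1) (s₁ := ({b ∈ B | G.degree b = 1} : Finset V))
      fun b hb => (mem_filter.1 hb).2] at h2
  simp only [sum_const, smul_eq_mul, mul_one] at h2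
  omega

/-- The face count for a bipartite graph in which the leaves from `L` are disregarded. -/
lemma two_mul_card_face_add_le (S : EmbeddingScheme G) (hAB : G.IsBipartiteWith (A : Set V) B)
    (hLA : L ⊆ A) (hL : ∀ a ∈ L, G.degree a = 1)
    (hB : ∀ b ∈ B, ∀ a, G.Adj b a →
      (G.degree b = 1 ∧ a ∉ L) ∨ ∃ a', a' ≠ a ∧ G.Adj b a' ∧ a' ∉ L) :
    2 * Nat.card S.Face + #L ≤ #G.edgeFinset + #{b ∈ B | G.degree b = 1} := by
  have : Finite S.Face := Quot.finite _
  have : DecidableEq S.Face := Classical.decEq _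
  have := Fintype.ofFinite S.Face
  have h1 : ∑ f : S.Face, 4 ≤ ∑ f : S.Face, ∑ x with S.faceOf x = f, flagWeight A L x :=
    sum_le_sum fun f _ => S.four_le_sum_flagWeight hAB hL hB f
  rw [sum_fiberwise] at h1
  have h2 := sum_flagWeight_add_le hAB hLA hL
  simp only [sum_const, smul_eq_mul, card_univ] at h1
  rw [Nat.card_eq_fintype_card]
  omega

end Bipartite

lemma ncard_isolated_le_card_connectedComponent [Finite V] (G : SimpleGraph V) :
    {v : V | G.neighborSet v = ∅}.ncard ≤ Nat.card G.ConnectedComponent := by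
  rw [← Nat.card_coe_set_eq]
  have : Finite G.ConnectedComponent := Quot.finite _
  refine Nat.card_le_card_of_injective
    (fun v : {v : V | G.neighborSet v = ∅} => G.connectedComponentMk v.1) ?_
  rintro ⟨v, hv⟩ ⟨w, hw⟩ h
  obtain ⟨p⟩ := SimpleGraph.ConnectedComponent.exact h
  cases p with
  | nil => rfl
  | cons h _ => exact (Set.eq_empty_iff_forall_notMem.1 hv _ h).elim

end EmbeddingScheme

/-! ### Euler's formula for a sequence that cannot be extended -/

open Finset in
/-- If every vertex of `B` outside `T` has at least three neighbours in `N(T)`, then `B` is small. -/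
lemma card_le_of_three_neighbors {V : Type*} [Fintype V] [DecidableEq V] {G : SimpleGraph V}
    [DecidableRel G.Adj] {A B T : Finset V} {g : ℕ} (hg : EulerGenusLE G g)
    (hunion : A ∪ B = univ) (hAB : G.IsBipartiteWith (A : Set V) B)
    (hdeg : ∀ b ∈ B, G.degree b ≤ 4) (hTB : T ⊆ B)
    (hT : ∀ b ∈ B, b ∉ T → 3 ≤ #(G.neighborFinset b ∩ T.biUnion fun v => G.neighborFinset v)) :
    #B ≤ 2 * g + 8 * #T := by
  obtain ⟨S, hS⟩ := hg
  set U := T.biUnion fun v => G.neighborFinset v with hU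
  set L := {a ∈ A \ U | G.degree a = 1} with hLdef
  have hUA : U ⊆ A := by
    intro a ha
    obtain ⟨b, hb, hab⟩ := mem_biUnion.1 ha
    simpa using hAB.symm.mem_of_mem_adj (mem_coe.2 (hTB hb)) ((G.mem_neighborFinset _ _).1 hab)
  have hLU : ∀ a ∈ U, a ∉ L := by
    intro a ha hl
    simp [hLdef, ha] at hl
  have hnbT : ∀ b ∈ T, ∀ a, G.Adj b a → a ∈ U := fun b hb a hab =>
    mem_biUnion.2 ⟨b, hb, (G.mem_neighborFinset _ _).2 hab⟩
  have hface := S.two_mul_card_face_add_le (L := L) hAB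
    (fun a ha => (mem_sdiff.1 (mem_filter.1 ha).1).1) (fun a ha => (mem_filter.1 ha).2) (by
      intro b hb a hab
      have hother : 1 < #(G.neighborFinset b ∩ U) →
          ∃ a', a' ≠ a ∧ G.Adj b a' ∧ a' ∉ L := by
        intro h
        obtain ⟨a', ha', hne⟩ := exists_mem_ne h a
        rw [mem_inter, G.mem_neighborFinset] at ha'
        exact ⟨a', hne, ha'.1, hLU _ ha'.2⟩
      by_cases hbT : b ∈ T
      · by_cases hd : G.degree b = 1
        · exact Or.inl ⟨hd, hLU _ (hnbT b hbT a hab)⟩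
        · right
          apply hother
          have hsub : G.neighborFinset b ⊆ U := fun c hc =>
            hnbT b hbT c ((G.mem_neighborFinset _ _).1 hc)
          rw [inter_eq_left.2 hsub, G.card_neighborFinset_eq_degree]
          have : 0 < G.degree b := (G.degree_pos_iff_exists_adj b).2 ⟨a, hab⟩
          omega
      · exact Or.inr (hother (by have := hT b hb hbT; omega)))
  -- Vertices of B outside `T` have degree at least 3, so every leaf of B is in `T`.
  have hn1 : #{b ∈ B | G.degree b = 1} ≤ #T := by
    refine card_le_card fun b hb => ?_
    by_contra hbT
    have h1 := hT b (mem_filter.1 hb).1 hbT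
    have h2 := card_le_card (inter_subset_left (s₁ := G.neighborFinset b) (s₂ := U))
    rw [G.card_neighborFinset_eq_degree, (mem_filter.1 hb).2] at h2
    omega
  have hiso := EmbeddingScheme.ncard_isolated_le_card_connectedComponent G
  have hisoA : #{a ∈ A | G.degree a = 0} ≤ {v : V | G.neighborSet v = ∅}.ncard := by
    rw [← Set.ncard_coe_finset]
    refine Set.ncard_le_ncard (fun v hv => ?_) (Set.toFinite _)
    have := (mem_filter.1 (mem_coe.1 hv)).2
    rw [Set.mem_ofPred_eq, Set.eq_empty_iff_forall_notMem]
    intro w hw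
    exact absurd ((G.degree_pos_iff_exists_adj v).2 ⟨w, hw⟩) (by omega)
  have hV : Nat.card V = #A + #B := by
    rw [Nat.card_eq_fintype_card, ← card_univ, ← hunion, card_union_of_disjoint]
    simpa using hAB.disjoint
  have hE : G.edgeSet.ncard = #G.edgeFinset := by
    rw [← SimpleGraph.coe_edgeFinset, Set.ncard_coe_finset]
  -- edges counted from `A`
  have hEA := SimpleGraph.isBipartiteWith_sum_degrees_eq_card_edges hAB
  have hsplit := sum_sdiff hUA (f := fun a => G.degree a)
  -- The deficit at leaves is repaid by the term `#L` of `hface`, the deficit at isolated vertices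
  -- by their components.
  have hout : 2 * #(A \ U) ≤ ∑ a ∈ A \ U, G.degree a + #L + 2 * #{a ∈ A | G.degree a = 0} := by
    have h0 : #{a ∈ A \ U | G.degree a = 0} ≤ #{a ∈ A | G.degree a = 0} :=
      card_le_card (filter_subset_filter _ sdiff_subset)
    have h1 : ∑ a ∈ A \ U, 2 ≤ ∑ a ∈ A \ U, (G.degree a + (if G.degree a = 1 then 1 else 0)
        + 2 * (if G.degree a = 0 then 1 else 0)) := by
      refine sum_le_sum fun a _ => ?_
      split_ifs <;> omega
    rw [sum_add_distrib, sum_add_distrib, ← mul_sum, ← card_filter, ← card_filter, sum_const,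
      smul_eq_mul, ← hLdef] at h1
    omega
  have hcardA : #(A \ U) + #U = #A := card_sdiff_add_card_eq_card hUA
  -- edges between `B` and `U`
  have hdouble : ∑ a ∈ U, G.degree a = ∑ b ∈ B, #(G.neighborFinset b ∩ U) := by
    have h := sum_card_bipartiteAbove_eq_sum_card_bipartiteBelow (s := U) (t := B) G.Adj
    rw [show ∑ a ∈ U, G.degree a = ∑ a ∈ U, #(bipartiteAbove G.Adj B a) from ?_, h]
    · refine sum_congr rfl fun b _ => ?_
      congr 1
      ext a
      simp [bipartiteBelow, G.adj_comm, and_comm]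
    · refine sum_congr rfl fun a ha => ?_
      rw [← G.card_neighborFinset_eq_degree]
      congr 1
      ext b
      simp only [bipartiteAbove, mem_filter, G.mem_neighborFinset]
      refine ⟨fun h => ⟨?_, h⟩, fun h => h.2⟩
      simpa using hAB.mem_of_mem_adj (mem_coe.2 (hUA ha)) h
  have hBT := sum_sdiff hTB (f := fun b => #(G.neighborFinset b ∩ U))
  have hcardB : #(B \ T) + #T = #B := card_sdiff_add_card_eq_card hTB
  have hlow : 3 * #(B \ T) ≤ ∑ b ∈ B \ T, #(G.neighborFinset b ∩ U) := by
    rw [mul_comm, ← smul_eq_mul]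
    exact card_nsmul_le_sum _ _ _ fun b hb => hT b (mem_sdiff.1 hb).1 (mem_sdiff.1 hb).2
  have hTdeg : ∑ b ∈ T, #(G.neighborFinset b ∩ U) = ∑ b ∈ T, G.degree b := by
    refine sum_congr rfl fun b hb => ?_
    rw [inter_eq_left.2, G.card_neighborFinset_eq_degree]
    exact fun c hc => hnbT b hb c ((G.mem_neighborFinset _ _).1 hc)
  have hUcard : #U ≤ ∑ b ∈ T, G.degree b := by
    refine card_biUnion_le.trans (le_of_eq (sum_congr rfl fun b _ => ?_))
    exact G.card_neighborFinset_eq_degree b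
  have hTle : ∑ b ∈ T, G.degree b ≤ 4 * #T := by
    rw [mul_comm, ← smul_eq_mul]
    exact sum_le_card_nsmul _ _ _ fun b hb => hdeg b (hTB hb)
  rw [EmbeddingScheme.eulerGenus, EmbeddingScheme.numFaces, hV, hE] at hS
  push_cast at hS
  -- Twice the genus inequality, with faces, components and A \ U eliminated, gives |B| ≤ 2g + 3|T|
  -- + 2|U| - D + n₁, where D is the degree sum over T and n₁ the number of leaves in B. Now n₁ ≤
  -- |T| and |U| ≤ D ≤ 4|T|.
  omega

/-! ### Greedy extension and the final bound -/

lemma isOrderedSeq_snoc {V : Type*} {G : SimpleGraph V} {n : ℕ} {v : Fin n → V} {b : V}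
    (hv : IsOrderedSeq G v)
    (hb : (closedNbhd G b ∩ ⋃ j, closedNbhd G (v j)).ncard ≤ 2) :
    IsOrderedSeq G (Fin.snoc v b : Fin (n + 1) → V) := by
  intro i
  induction i using Fin.lastCases with
  | last =>
    convert hb using 3
    · simp
    · ext x
      simp [Fin.exists_fin_succ', Fin.castSucc_lt_last]
  | cast i =>
    convert hv i using 3
    · simp
    · ext x
      simp [Fin.exists_fin_succ', Fin.not_lt.2 (Fin.le_last _)]

open Finset in
/-- Long ordered sequences exist in large classes, by extending greedily. -/
theorem forcesOrderedSeq_succ (g : ℕ) : ForcesOrderedSeq g (g + 1) (10 * g) := by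
  classical
  intro V _ _ G A B hg hunion hAB hcard hdeg
  have hdeg' : ∀ b ∈ B, G.degree b ≤ 4 := by
    intro b hb
    rw [← G.card_neighborFinset_eq_degree, ← Set.ncard_coe_finset, SimpleGraph.coe_neighborFinset]
    exact hdeg b hb
  have key : ∀ n ≤ g + 1, ∃ v : Fin n → V,
      Function.Injective v ∧ (∀ i, v i ∈ B) ∧ IsOrderedSeq G v := by
    intro n
    induction n with
    | zero => exact fun _ => ⟨Fin.elim0, fun i => i.elim0, fun i => i.elim0, fun i => i.elim0⟩
    | succ n ih =>
      intro hn
      obtain ⟨v, hinj, hvB, hord⟩ := ih (by omega)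
      have hTB : univ.image v ⊆ B := by
        intro b hb
        obtain ⟨i, -, rfl⟩ := mem_image.1 hb
        exact hvB i
      have hTcard : #(univ.image v) = n := by rw [card_image_of_injective _ hinj, card_fin]
      obtain ⟨b, hb, hbT, hlt⟩ : ∃ b ∈ B, b ∉ univ.image v ∧
          #(G.neighborFinset b ∩ (univ.image v).biUnion fun v => G.neighborFinset v) < 3 := by
        by_contra! h
        have := card_le_of_three_neighbors hg hunion hAB hdeg' hTB h
        omega
      have hbv : ∀ i, v i ≠ b := fun i h => hbT (mem_image.2 ⟨i, mem_univ _, h⟩)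
      refine ⟨Fin.snoc v b, ?_, ?_, isOrderedSeq_snoc hord ?_⟩
      · rw [Fin.snoc_injective_iff]
        exact ⟨hinj, fun ⟨i, hi⟩ => hbv i hi⟩
      · intro i
        induction i using Fin.lastCases with
        | last => simpa using hb
        | cast i => simpa using hvB i
      -- Since B is independent, closed neighbourhoods of distinct vertices of B meet only in common
      -- neighbours.
      · have hnadj : ∀ x y, x ∈ B → y ∈ B → ¬ G.Adj x y := by
          intro x y hx hy h
          have := hAB.symm.mem_of_mem_adj (mem_coe.2 hx) h
          exact Set.disjoint_left.1 hAB.disjoint this (mem_coe.2 hy)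
        refine le_trans ?_ (Nat.le_of_lt_succ hlt)
        rw [← Set.ncard_coe_finset]
        refine Set.ncard_le_ncard ?_ (Set.toFinite _)
        rintro x ⟨hx, hx'⟩
        obtain ⟨i, hi⟩ := Set.mem_iUnion.1 hx'
        rcases hx with rfl | hx
        · rcases hi with h | h
          · exact (hbv i h.symm).elim
          · exact (hnadj _ _ (hvB i) hb h).elim
        · rcases hi with rfl | h
          · exact (hnadj _ _ hb (hvB i) hx).elim
          · simp only [coe_inter, Set.mem_inter_iff, mem_coe, SimpleGraph.mem_neighborFinset,
              mem_biUnion, mem_image, mem_univ, true_and]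
            exact ⟨hx, v i, ⟨i, rfl⟩, h⟩
  exact key (g + 1) le_rfl

lemma abs_lambdaConst_sub_lt : |lambdaConst - 16.6537| < 0.00005 := by
  have h1 := Real.log_two_gt_d9
  have h2 := Real.log_two_lt_d9
  rw [lambdaConst, abs_lt]
  constructor <;> linarith

theorem lemma8 :
    |lambdaConst - 16.6537| < 0.00005 ∧
    ∀ g : ℕ, 2 ≤ g →
      IsLeast {b : ℕ | ForcesOrderedSeq g (g + 1) b} (orderedBound g (g + 1)) ∧
      (orderedBound g (g + 1) : ℝ) ≤
        lambdaConst * ((g : ℝ) - 2)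
          + 2 * ((⌈Real.sqrt (3 / 2 * ((g : ℝ) - 2))⌉ : ℤ) : ℝ) + 33 := by
  refine ⟨abs_lambdaConst_sub_lt, fun g hg => ⟨⟨?_, fun b hb => Nat.sInf_le hb⟩, ?_⟩⟩
  · exact Nat.sInf_mem ⟨_, forcesOrderedSeq_succ g⟩
  · have h1 : (orderedBound g (g + 1) : ℝ) ≤ 10 * g := by
      exact_mod_cast Nat.sInf_le (s := {b | ForcesOrderedSeq g (g + 1) b}) (forcesOrderedSeq_succ g)
    have h2 : (0 : ℝ) ≤ ((⌈Real.sqrt (3 / 2 * ((g : ℝ) - 2))⌉ : ℤ) : ℝ) := by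
      exact_mod_cast Int.ceil_nonneg (Real.sqrt_nonneg _)
    have h3 : (2 : ℝ) ≤ g := by exact_mod_cast hg
    have h4 := (abs_lt.1 abs_lambdaConst_sub_lt).1
    -- Since 10g = 10(g - 2) + 20, it suffices that λ ≥ 10 and 20 ≤ 33; the square root term is only
    -- needed to be nonnegative.
    have h5 : 10 * ((g : ℝ) - 2) ≤ lambdaConst * (g - 2) :=
      mul_le_mul_of_nonneg_right (by linarith) (by linarith)
    linarith
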